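/- Let $\mathbb{D}$ be the open unit disc and let $H^2$ be the Hardy space of all holomorphic functions $f$ on $\mathbb{D}$ with $\sup_{0\le r<1}\big(\frac1{2\pi}\int_0^{2\pi}|f(re^{it})|^2\,dt\big)^{1/2}<\infty$. Let $\theta$ be an inner function, that is, a holomorphic function on $\mathbb{D}$ with $|\theta|\le 1$ on $\mathbb{D}$ whose radial limits $\lim_{r\to1^-}\theta(re^{it})$ exist and have modulus one for almost every $t\in[0,2\pi]$. Let $\varphi$ be an elliptic automorphism of $\mathbb{D}$, that is, a biholomorphic map of $\mathbb{D}$ onto itself with exactly one fixed point in $\mathbb{D}$, and let $C_\varphi f=f\circ\varphi$. Then the following are equivalent: (a) $\theta H^2$ is invariant under $C_\varphi$, that is, $C_\varphi(\theta H^2)\subseteq\theta H^2$. (b) $\dfrac{\theta\circ\varphi}{\theta}$ is a unimodular constant, that is, there is $c\in\mathbb{C}$ with $|c|=1$ such that $\dfrac{\theta(\varphi(z))}{\theta(z)}=c$ for all $z\in\mathbb{D}$ with $\theta(z)\ne0$. Moreover, in this case, if $w\in\mathbb{D}$ is the unique fixed point of $\varphi$ in $\mathbb{D}$, then $$\frac{\theta\circ\varphi}{\theta}\equiv\begin{cases}\varphi'(w)^{\operatorname{mult}_\theta(w)}&\text{if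 }\theta(w)=0,\\ 1&\text{otherwise,}\end{cases}$$ where $\operatorname{mult}_\theta(w)$ is the multiplicity of $w$ as a zero of $\theta$. -/

import Mathlib

namespace HardyDisc

/-- The open unit disc as a subset of `ℂ`. Functions on the disc are represented by functions
`ℂ → ℂ`; only their values on the disc matter in all the definitions below. -/
abbrev disc : Set ℂ := Metric.ball (0 : ℂ) 1

/-- The integral mean `((1 / 2π) ∫ t in 0..2π, |f (r e^{it})|²)^{1/2}`. -/
noncomputable def integralMean (f : ℂ → ℂ) (r : ℝ) : ℝ :=
  Real.sqrt ((2 * Real.pi)⁻¹ * ∫ t in (0 : ℝ)..(2 * Real.pi), ‖f (circleMap 0 r t)‖ ^ 2)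

/-- The Hardy space `H²`: functions holomorphic on the disc whose integral means over the circles
of radius `0 ≤ r < 1` have a finite supremum. -/
def hardySpace : Set (ℂ → ℂ) :=
  {f | DifferentiableOn ℂ f disc ∧ BddAbove (integralMean f '' Set.Ico 0 1)}

/-- Inner functions: holomorphic on the disc, bounded there by one in modulus, with radial limits
that (exist and) have modulus one at almost every boundary point. -/
structure IsInner (θ : ℂ → ℂ) : Prop where
  holo : DifferentiableOn ℂ θ disc
  norm_le_one : ∀ z ∈ disc, ‖θ z‖ ≤ 1
  radial_limit : ∀ᵐ t ∂(MeasureTheory.volume.restrict (Set.Ioc (0 : ℝ) (2 * Real.pi))),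
    ∃ ζ : ℂ, ‖ζ‖ = 1 ∧
      Filter.Tendsto (fun r : ℝ => θ (circleMap 0 r t)) (nhdsWithin 1 (Set.Iio 1)) (nhds ζ)

/-- The set `θ H²` of all functions that agree on the disc with `θ g` for some `g ∈ H²`. -/
def beurlingSubspace (θ : ℂ → ℂ) : Set (ℂ → ℂ) :=
  {h | ∃ g ∈ hardySpace, ∀ z ∈ disc, h z = θ z * g z}

/-- The composition operator `C_φ f = f ∘ φ`. -/
def compositionOp (φ f : ℂ → ℂ) : ℂ → ℂ := f ∘ φ

/-- `C_φ S ⊆ S`. -/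
def IsInvariantUnderComp (φ : ℂ → ℂ) (S : Set (ℂ → ℂ)) : Prop :=
  Set.MapsTo (compositionOp φ) S S

/-- Automorphisms of the disc: holomorphic self maps with a holomorphic inverse. -/
def IsDiscAutomorphism (φ : ℂ → ℂ) : Prop :=
  DifferentiableOn ℂ φ disc ∧ Set.MapsTo φ disc disc ∧
    ∃ ψ : ℂ → ℂ, DifferentiableOn ℂ ψ disc ∧ Set.MapsTo ψ disc disc ∧ Set.InvOn ψ φ disc disc

/-- Elliptic automorphisms: exactly one fixed point in the disc. -/
def IsEllipticAutomorphism (φ : ℂ → ℂ) : Prop :=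
  IsDiscAutomorphism φ ∧ ∃! w : ℂ, w ∈ disc ∧ φ w = w

/-- The function `(θ ∘ φ) / θ`, defined on the disc off the zero set of `θ` (a discrete set when
`θ` is inner), is identically equal to `c`. -/
def QuotientIsConst (θ φ : ℂ → ℂ) (c : ℂ) : Prop :=
  ∀ z ∈ disc, θ z ≠ 0 → θ (φ z) / θ z = c

end HardyDisc

namespace HardyDisc

open Complex Metric Real Filter Topology Set

/-! If `θ H²` is invariant, then `θ ∘ φ = θ g` with `g ∈ H²`, since `θ = θ · 1`. As `|θ|` tends to 1
radially almost everywhere, `|θ g| ≤ 1` forces `|g| ≤ 1` (`IsInner.norm_le_one_of_mul`). At the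
fixed point `w`, leading coefficients give `g(w) = φ'(w)^n`, with `n` the order of `θ` at `w`, and
`|φ'(w)| = 1`. So `|g|` attains its maximum at an interior point and `g` is constant. When `θ(w) ≠
0`, `n = 0` and the constant is 1.

Conversely, `θ ∘ φ = c θ` gives `(θ g) ∘ φ = θ · c (g ∘ φ)`, and `g ∘ φ ∈ H²` by Littlewood
subordination.

Boundary values of `g` are never used: all estimates are Poisson integrals over circles of radius
less than 1. -/

lemma integralMean_sq (f : ℂ → ℂ) (r : ℝ) :
    integralMean f r ^ 2 = circleAverage (fun z ↦ ‖f z‖ ^ 2) 0 r := by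
  rw [integralMean, Real.sq_sqrt, circleAverage_def, smul_eq_mul]
  exact mul_nonneg (by positivity)
    (intervalIntegral.integral_nonneg (by positivity) fun _ _ ↦ by positivity)

lemma closedBall_subset_disc {r : ℝ} (hr : r < 1) : closedBall (0 : ℂ) r ⊆ disc :=
  closedBall_subset_ball hr

lemma circleIntegrable_of_continuousOn_disc {E : Type*} [NormedAddCommGroup E] {f : ℂ → E}
    (hf : ContinuousOn f disc) {r : ℝ} (h0 : 0 ≤ r) (h1 : r < 1) : CircleIntegrable f 0 r :=
  (hf.mono (sphere_subset_closedBall.trans (closedBall_subset_disc h1))).circleIntegrable h0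

lemma diffContOnCl_of_differentiableOn_disc {f : ℂ → ℂ} (hf : DifferentiableOn ℂ f disc) {r : ℝ}
    (h1 : r < 1) : DiffContOnCl ℂ f (ball 0 r) :=
  (hf.mono (closure_ball_subset_closedBall.trans (closedBall_subset_disc h1))).diffContOnCl

lemma exists_circleAverage_le {f : ℂ → ℂ} (hf : f ∈ hardySpace) :
    ∃ M : ℝ, 0 ≤ M ∧ ∀ r, 0 ≤ r → r < 1 → circleAverage (fun z ↦ ‖f z‖ ^ 2) 0 r ≤ M := by
  obtain ⟨-, B, hB⟩ := hf
  refine ⟨B ^ 2, sq_nonneg B, fun r h0 h1 ↦ ?_⟩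
  rw [← integralMean_sq]
  exact pow_le_pow_left₀ (Real.sqrt_nonneg _) (hB ⟨r, ⟨h0, h1⟩, rfl⟩) 2

lemma mem_hardySpace_of_circleAverage_le {f : ℂ → ℂ} (hf : DifferentiableOn ℂ f disc) {M : ℝ}
    (hM : ∀ r, 0 ≤ r → r < 1 → circleAverage (fun z ↦ ‖f z‖ ^ 2) 0 r ≤ M) : f ∈ hardySpace := by
  refine ⟨hf, √M, ?_⟩
  rintro _ ⟨r, ⟨h0, h1⟩, rfl⟩
  exact Real.le_sqrt_of_sq_le (integralMean_sq f r ▸ hM r h0 h1)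

lemma one_mem_hardySpace : (fun _ ↦ 1 : ℂ → ℂ) ∈ hardySpace :=
  mem_hardySpace_of_circleAverage_le (M := 1) (differentiableOn_const _) fun r _ _ ↦ by
    simp [circleAverage_const]

/-! ### Poisson kernel, as the real part of the Herglotz kernel. -/

lemma re_herglotz_nonneg {a ζ : ℂ} {R : ℝ} (ha : a ∈ ball 0 R) (hζ : ζ ∈ sphere (0 : ℂ) R) :
    0 ≤ (herglotzRieszKernel 0 a ζ).re := by
  have := le_re_herglotzRieszKernel hζ ha
  have h : ‖a‖ < R := by simpa using ha
  refine le_trans (div_nonneg ?_ ?_) this <;> simp <;> linarith [norm_nonneg a]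

lemma re_herglotz_le {a ζ : ℂ} {R : ℝ} (ha : a ∈ ball 0 R) (hζ : ζ ∈ sphere (0 : ℂ) R) :
    (herglotzRieszKernel 0 a ζ).re ≤ (R + ‖a‖) / (R - ‖a‖) := by
  simpa [herglotzRieszKernel_def] using re_herglotzRieszKernel_le hζ ha

lemma continuousOn_re_herglotz {a : ℂ} {R : ℝ} (ha : a ∈ ball 0 R) :
    ContinuousOn (fun ζ ↦ (herglotzRieszKernel 0 a ζ).re) (sphere 0 R) := by
  have := continuousOn_herglotzRieszKernel_sphere ha
  rw [abs_of_pos (pos_of_mem_ball ha)] at this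
  exact Complex.continuous_re.comp_continuousOn this

lemma circleIntegrable_re_herglotz_mul {u : ℂ → ℝ} (hu : ContinuousOn u disc) {a : ℂ} {R : ℝ}
    (ha : a ∈ ball 0 R) (h1 : R < 1) :
    CircleIntegrable (fun ζ ↦ (herglotzRieszKernel 0 a ζ).re * u ζ) 0 R := by
  have hR : 0 < R := pos_of_mem_ball ha
  refine ContinuousOn.circleIntegrable hR.le ((continuousOn_re_herglotz ha).mul
    (hu.mono (sphere_subset_closedBall.trans (closedBall_subset_disc h1))))

/-- The modulus of a holomorphic function is at most its Poisson integral. -/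
lemma norm_le_circleAverage_re_herglotz {f : ℂ → ℂ} (hf : DifferentiableOn ℂ f disc) {a : ℂ}
    {R : ℝ} (ha : a ∈ ball 0 R) (h1 : R < 1) :
    ‖f a‖ ≤ circleAverage (fun ζ ↦ (herglotzRieszKernel 0 a ζ).re * ‖f ζ‖) 0 R := by
  have hP := (diffContOnCl_of_differentiableOn_disc hf h1).circleAverage_re_herglotzRieszKernel_smul
    ha
  rw [← hP, circleAverage_def, circleAverage_def, norm_smul, Real.norm_of_nonneg (by positivity),
    smul_eq_mul]
  gcongr
  refine (intervalIntegral.norm_integral_le_integral_norm (by positivity)).trans_eq ?_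
  refine intervalIntegral.integral_congr fun t _ ↦ ?_
  have := re_herglotz_nonneg ha (circleMap_mem_sphere (0 : ℂ) (pos_of_mem_ball ha).le t)
  simp [abs_of_nonneg this]

lemma circleAverage_re_herglotz {a : ℂ} {R : ℝ} (ha : a ∈ ball 0 R) :
    circleAverage (fun ζ ↦ (herglotzRieszKernel 0 a ζ).re * (1 : ℝ)) 0 R = 1 := by
  have hd : DiffContOnCl ℂ (fun _ : ℂ ↦ (1 : ℂ)) (ball 0 R) := diffContOnCl_const
  have hi : CircleIntegrable ((re ∘ herglotzRieszKernel 0 a) • fun _ : ℂ ↦ (1 : ℂ)) 0 R :=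
    ((continuousOn_re_herglotz ha).smul continuousOn_const).circleIntegrable
      (pos_of_mem_ball ha).le
  have h := Complex.reCLM.circleAverage_comp_comm hi
  rw [hd.circleAverage_re_herglotzRieszKernel_smul ha] at h
  simpa [Function.comp_def] using h

lemma circleAverage_re_herglotz_mul_le {u : ℂ → ℝ} (hu : ContinuousOn u disc) (h0 : ∀ z, 0 ≤ u z)
    {a : ℂ} {R : ℝ} (ha : a ∈ ball 0 R) (h1 : R < 1) :
    circleAverage (fun ζ ↦ (herglotzRieszKernel 0 a ζ).re * u ζ) 0 R ≤
      (R + ‖a‖) / (R - ‖a‖) * circleAverage u 0 R := by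
  have hR : 0 < R := pos_of_mem_ball ha
  rw [← smul_eq_mul, ← circleAverage_fun_smul]
  refine circleAverage_mono (circleIntegrable_re_herglotz_mul hu ha h1)
    (circleIntegrable_of_continuousOn_disc (f := fun ζ ↦ ((R + ‖a‖) / (R - ‖a‖)) • u ζ)
      (continuousOn_const.mul hu) hR.le h1) fun ζ hζ ↦ ?_
  rw [abs_of_pos hR] at hζ
  exact mul_le_mul_of_nonneg_right (re_herglotz_le ha hζ) (h0 ζ)

/-! ### Composition operators on the Hardy space. -/

lemma continuousOn_norm_sq {f : ℂ → ℂ} (hf : DifferentiableOn ℂ f disc) :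
    ContinuousOn (fun z ↦ ‖f z‖ ^ 2) disc := hf.continuousOn.norm.pow 2

/-- Littlewood subordination for the Hardy space. -/
lemma comp_mem_hardySpace {φ h : ℂ → ℂ} (hφ : DifferentiableOn ℂ φ disc)
    (hmaps : MapsTo φ disc disc) (hh : h ∈ hardySpace) : h ∘ φ ∈ hardySpace := by
  obtain ⟨M, hM0, hM⟩ := exists_circleAverage_le hh
  have hd : DifferentiableOn ℂ (h ∘ φ) disc := hh.1.comp hφ hmaps
  set b := ‖φ 0‖
  have hb : b < 1 := by simpa using hmaps (mem_ball_self one_pos)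
  refine mem_hardySpace_of_circleAverage_le (M := 4 / (1 - b) * M) hd fun r h0 h1 ↦ ?_
  have hsub : φ '' closedBall 0 r ⊆ disc := image_subset_iff.2 fun z hz ↦
    hmaps (closedBall_subset_disc h1 hz)
  have hcpt : IsCompact (φ '' closedBall 0 r) := (isCompact_closedBall _ _).image_of_continuousOn
    (hφ.continuousOn.mono (closedBall_subset_disc h1))
  obtain ⟨ρ, hρ, hρsub⟩ := exists_lt_subset_ball hcpt.isClosed hsub
  obtain ⟨R, hR, hR1⟩ := exists_between (max_lt hρ (show (1 + b) / 2 < 1 by linarith))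
  have hρR : ρ < R := (le_max_left _ _).trans_lt hR
  have hbR : (1 + b) / 2 < R := (le_max_right _ _).trans_lt hR
  have hb0 : 0 ≤ b := norm_nonneg _
  have hR0 : 0 < R := by linarith
  have hmem : ∀ z ∈ closedBall (0 : ℂ) r, φ z ∈ ball (0 : ℂ) R := fun z hz ↦
    ball_subset_ball hρR.le (hρsub (mem_image_of_mem _ hz))
  have hcont := continuousOn_norm_sq hh.1
  have hint : CircleIntegrable (fun z ↦ ‖h z‖ ^ 2) 0 R :=
    circleIntegrable_of_continuousOn_disc hcont hR0.le hR1
  have hintC : CircleIntegrable (fun z ↦ ((‖h z‖ ^ 2 : ℝ) : ℂ)) 0 R :=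
    circleIntegrable_of_continuousOn_disc (Complex.continuous_ofReal.comp_continuousOn hcont)
      hR0.le hR1
  -- `Re F` is a harmonic majorant of `|h|²` on the ball of radius `R`. Holomorphy of `F ∘ φ` lets
  -- the mean value property evaluate its average at `φ 0`.
  set F : ℂ → ℂ := fun w ↦
    circleAverage (fun ζ ↦ herglotzRieszKernel 0 w ζ • ((‖h ζ‖ ^ 2 : ℝ) : ℂ)) 0 R
  have hFd : DifferentiableOn ℂ F (ball 0 R) := fun w hw ↦
    (hasDerivAt_circleAverage_herglotzRieszKernel_smul hintC
      hw).differentiableAt.differentiableWithinAt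
  have hFre : ∀ w ∈ ball (0 : ℂ) R, (F w).re =
      circleAverage (fun ζ ↦ (herglotzRieszKernel 0 w ζ).re * ‖h ζ‖ ^ 2) 0 R := fun w hw ↦
    re_circleAverage_herglotzRieszKernel_smul hint hw
  have hle : ∀ w ∈ ball (0 : ℂ) R, ‖h w‖ ^ 2 ≤ (F w).re := fun w hw ↦ by
    rw [hFre w hw]
    have := norm_le_circleAverage_re_herglotz (f := fun z ↦ h z ^ 2) (hh.1.pow 2) hw hR1
    simpa only [norm_pow] using this
  have hGd : DifferentiableOn ℂ (F ∘ φ) (closedBall 0 r) :=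
    hFd.comp (hφ.mono (closedBall_subset_disc h1)) hmem
  have hGc : DiffContOnCl ℂ (F ∘ φ) (ball 0 |r|) := by
    rw [abs_of_nonneg h0]
    exact (hGd.mono closure_ball_subset_closedBall).diffContOnCl
  have hGint : CircleIntegrable (F ∘ φ) 0 r :=
    (hGd.continuousOn.mono sphere_subset_closedBall).circleIntegrable h0
  have hzero : φ 0 ∈ ball (0 : ℂ) R := hmem 0 (mem_closedBall_self h0)
  calc circleAverage (fun z ↦ ‖(h ∘ φ) z‖ ^ 2) 0 r
      ≤ circleAverage (fun z ↦ ((F ∘ φ) z).re) 0 r := by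
        refine circleAverage_mono
          (circleIntegrable_of_continuousOn_disc (continuousOn_norm_sq hd) h0 h1) ?_ fun z hz ↦ ?_
        · exact (Complex.continuous_re.comp_continuousOn
            (hGd.continuousOn.mono sphere_subset_closedBall)).circleIntegrable h0
        · rw [abs_of_nonneg h0] at hz
          exact hle _ (hmem z (sphere_subset_closedBall hz))
    _ = (F (φ 0)).re := by
        rw [← Function.comp_apply (f := F), ← hGc.circleAverage]
        exact (Complex.reCLM.circleAverage_comp_comm hGint)
    _ ≤ (R + b) / (R - b) * M := by
        rw [hFre _ hzero]
        refine (circleAverage_re_herglotz_mul_le hcont (fun z ↦ by positivity) hzero hR1).trans ?_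
        exact mul_le_mul_of_nonneg_left (hM R hR0.le hR1)
          (div_nonneg (by linarith) (by linarith))
    _ ≤ 4 / (1 - b) * M := by
        -- From `(1 + b) / 2 < R < 1`: `R + b < 2` and `R - b > (1 - b) / 2`.
        refine mul_le_mul_of_nonneg_right ?_ hM0
        rw [div_le_div_iff₀ (by linarith) (by linarith)]
        nlinarith

/-! ### Division by an inner function. -/

lemma IsInner.tendsto_circleAverage {θ : ℂ → ℂ} (hθ : IsInner θ) :
    Tendsto (fun r ↦ circleAverage (fun z ↦ (1 - ‖θ z‖) ^ 2) 0 r) (𝓝[<] 1) (𝓝 0) := by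
  have hmem : ∀ᶠ r : ℝ in 𝓝[<] 1, 0 < r ∧ r < 1 := Ioo_mem_nhdsLT one_pos
  have hcont : ContinuousOn (fun z ↦ (1 - ‖θ z‖) ^ 2) disc :=
    (continuousOn_const.sub hθ.holo.continuousOn.norm).pow 2
  have key : Tendsto (fun r : ℝ ↦ ∫ t in (0 : ℝ)..2 * π, (1 - ‖θ (circleMap 0 r t)‖) ^ 2)
      (𝓝[<] 1) (𝓝 (∫ _ in (0 : ℝ)..2 * π, (0 : ℝ))) := by
    refine intervalIntegral.tendsto_integral_filter_of_dominated_convergence (fun _ ↦ 1) ?_ ?_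
      intervalIntegrable_const ?_
    · filter_upwards [hmem] with r hr
      rw [uIoc_of_le (by positivity)]
      exact (circleIntegrable_of_continuousOn_disc hcont hr.1.le hr.2).aestronglyMeasurable
    · filter_upwards [hmem] with r hr
      refine .of_forall fun t _ ↦ ?_
      have := hθ.norm_le_one (circleMap 0 r t) (closedBall_subset_disc hr.2
        (circleMap_mem_closedBall 0 hr.1.le t))
      rw [Real.norm_of_nonneg (sq_nonneg _)]
      nlinarith [norm_nonneg (θ (circleMap 0 r t))]
    · rw [uIoc_of_le (by positivity)]
      filter_upwards [(MeasureTheory.ae_restrict_iff' measurableSet_Ioc).1 hθ.radial_limit]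
        with t ht htm
      obtain ⟨ζ, hζ, hlim⟩ := ht htm
      simpa [hζ] using (tendsto_const_nhds (x := (1 : ℝ))).sub hlim.norm |>.pow 2
  simpa [circleAverage_def] using key.const_mul (2 * π)⁻¹

/-- A function of the Hardy space whose product with an inner function is bounded by one is itself
bounded by one. -/
lemma IsInner.norm_le_one_of_mul {θ g : ℂ → ℂ} (hθ : IsInner θ) (hg : g ∈ hardySpace)
    (hle : ∀ z ∈ disc, ‖θ z * g z‖ ≤ 1) {z : ℂ} (hz : z ∈ disc) : ‖g z‖ ≤ 1 := by
  obtain ⟨M, hM0, hM⟩ := exists_circleAverage_le hg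
  have hz1 : ‖z‖ < 1 := by simpa using hz
  have hθc : ContinuousOn (fun z ↦ (1 - ‖θ z‖) ^ 2) disc :=
    (continuousOn_const.sub hθ.holo.continuousOn.norm).pow 2
  have hgc := continuousOn_norm_sq hg.1
  -- Write `|g| = |θ g| + |g| (1 - |θ|)` and split the last product by weighted AM-GM. Letting `R →
  -- 1` with `ε` fixed kills the `θ` term; then `ε → 0` kills the `M` term.
  have bound : ∀ ε > 0, ∀ R, ‖z‖ < R → R < 1 → ‖g z‖ ≤ 1 + (R + ‖z‖) / (R - ‖z‖) *
      (ε * M + (4 * ε)⁻¹ * circleAverage (fun z ↦ (1 - ‖θ z‖) ^ 2) 0 R) := by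
    intro ε hε R hR hR1
    have hzR : z ∈ ball (0 : ℂ) R := by simpa using hR
    have hR0 : 0 < R := pos_of_mem_ball hzR
    set u : ℂ → ℝ := fun ζ ↦ ε * ‖g ζ‖ ^ 2 + (4 * ε)⁻¹ * (1 - ‖θ ζ‖) ^ 2 with hu
    have huc : ContinuousOn u disc := (continuousOn_const.mul hgc).add (continuousOn_const.mul hθc)
    have hone := circleAverage_re_herglotz hzR
    have hpt : ∀ ζ ∈ disc, ‖g ζ‖ ≤ 1 + u ζ := fun ζ hζ ↦ by
      have h1 := hle ζ hζ
      rw [norm_mul] at h1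
      have h2 : ‖g ζ‖ * (1 - ‖θ ζ‖) ≤ u ζ := by
        have h3 : u ζ - ‖g ζ‖ * (1 - ‖θ ζ‖) =
            (4 * ε)⁻¹ * (2 * ε * ‖g ζ‖ - (1 - ‖θ ζ‖)) ^ 2 := by
          simp only [hu]; field_simp; ring
        have : 0 ≤ u ζ - ‖g ζ‖ * (1 - ‖θ ζ‖) := by rw [h3]; positivity
        linarith
      nlinarith
    calc ‖g z‖ ≤ circleAverage (fun ζ ↦ (herglotzRieszKernel 0 z ζ).re * ‖g ζ‖) 0 R :=
          norm_le_circleAverage_re_herglotz hg.1 hzR hR1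
      _ ≤ circleAverage (fun ζ ↦ (herglotzRieszKernel 0 z ζ).re * 1 +
            (herglotzRieszKernel 0 z ζ).re * u ζ) 0 R := by
          refine circleAverage_mono
            (circleIntegrable_re_herglotz_mul hg.1.continuousOn.norm hzR hR1)
            ((circleIntegrable_re_herglotz_mul continuousOn_const hzR hR1).add
              (circleIntegrable_re_herglotz_mul huc hzR hR1)) fun ζ hζ ↦ ?_
          rw [abs_of_pos hR0] at hζ
          rw [← mul_add]
          exact mul_le_mul_of_nonneg_left
            (hpt ζ (closedBall_subset_disc hR1 (sphere_subset_closedBall hζ)))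
            (re_herglotz_nonneg hzR hζ)
      _ = 1 + circleAverage (fun ζ ↦ (herglotzRieszKernel 0 z ζ).re * u ζ) 0 R := by
          rw [circleAverage_fun_add
            (circleIntegrable_re_herglotz_mul continuousOn_const hzR hR1)
            (circleIntegrable_re_herglotz_mul huc hzR hR1), hone]
      _ ≤ 1 + (R + ‖z‖) / (R - ‖z‖) * circleAverage u 0 R := by
          gcongr
          exact circleAverage_re_herglotz_mul_le huc (fun ζ ↦ by positivity) hzR hR1
      _ = 1 + (R + ‖z‖) / (R - ‖z‖) * (ε * circleAverage (fun z ↦ ‖g z‖ ^ 2) 0 R +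
            (4 * ε)⁻¹ * circleAverage (fun z ↦ (1 - ‖θ z‖) ^ 2) 0 R) := by
          have h₁ : CircleIntegrable (fun ζ ↦ ε • ‖g ζ‖ ^ 2) 0 R :=
            circleIntegrable_of_continuousOn_disc (continuousOn_const.mul hgc) hR0.le hR1
          have h₂ : CircleIntegrable (fun ζ ↦ (4 * ε)⁻¹ • (1 - ‖θ ζ‖) ^ 2) 0 R :=
            circleIntegrable_of_continuousOn_disc (continuousOn_const.mul hθc) hR0.le hR1
          have := circleAverage_fun_add h₁ h₂
          rw [circleAverage_fun_smul, circleAverage_fun_smul] at this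
          rw [← smul_eq_mul ε, ← smul_eq_mul (4 * ε)⁻¹, ← this]
          rfl
      _ ≤ _ := by
          have := hM R hR0.le hR1
          have h' : 0 ≤ (R + ‖z‖) / (R - ‖z‖) :=
            div_nonneg (by linarith [norm_nonneg z]) (by linarith)
          gcongr
  have hmem : ∀ᶠ R : ℝ in 𝓝[<] 1, ‖z‖ < R ∧ R < 1 := Ioo_mem_nhdsLT hz1
  have step : ∀ ε > 0, ‖g z‖ ≤ 1 + (1 + ‖z‖) / (1 - ‖z‖) * (ε * M + (4 * ε)⁻¹ * 0) := by
    intro ε hε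
    have hid : Tendsto (fun R : ℝ ↦ R) (𝓝[<] 1) (𝓝 1) :=
      tendsto_nhdsWithin_of_tendsto_nhds tendsto_id
    refine ge_of_tendsto (tendsto_const_nhds.add (((hid.add_const ‖z‖).div (hid.sub_const ‖z‖)
      (by linarith)).mul (tendsto_const_nhds.add (tendsto_const_nhds.mul
        hθ.tendsto_circleAverage)))) ?_
    filter_upwards [hmem] with R hR using bound ε hε R hR.1 hR.2
  have hid : Tendsto (fun ε : ℝ ↦ ε) (𝓝[>] 0) (𝓝 0) :=
      tendsto_nhdsWithin_of_tendsto_nhds tendsto_id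
  have hlim := (tendsto_const_nhds (x := (1 : ℝ))).add
    ((tendsto_const_nhds (x := (1 + ‖z‖) / (1 - ‖z‖))).mul (hid.mul_const M))
  simp only [zero_mul, mul_zero, add_zero] at hlim
  refine ge_of_tendsto hlim ?_
  filter_upwards [self_mem_nhdsWithin] with ε hε
  simpa using step ε hε

lemma IsInner.exists_ne_zero {θ : ℂ → ℂ} (hθ : IsInner θ) : ∃ z ∈ disc, θ z ≠ 0 := by
  have : (MeasureTheory.ae (MeasureTheory.volume.restrict (Ioc (0 : ℝ) (2 * π)))).NeBot := by
    rw [MeasureTheory.ae_neBot, Ne, MeasureTheory.Measure.restrict_eq_zero]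
    simp [pi_pos]
  obtain ⟨t, ζ, hζ, hlim⟩ := hθ.radial_limit.exists
  have hζ0 : ζ ≠ 0 := norm_ne_zero_iff.1 (by simp [hζ])
  have hmem : ∀ᶠ r : ℝ in 𝓝[<] 1, 0 < r ∧ r < 1 := Ioo_mem_nhdsLT one_pos
  obtain ⟨r, hne, hr⟩ := ((hlim.eventually_ne hζ0).and hmem).exists
  exact ⟨_, closedBall_subset_disc hr.2 (circleMap_mem_closedBall 0 hr.1.le t), hne⟩

/-! ### Local analysis at the fixed point. -/

lemma isPreconnected_disc : IsPreconnected disc := (convex_ball (0 : ℂ) 1).isPreconnected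

lemma analyticOnNhd_disc {f : ℂ → ℂ} (hf : DifferentiableOn ℂ f disc) : AnalyticOnNhd ℂ f disc :=
  hf.analyticOnNhd isOpen_ball

lemma IsInner.analyticOrderAt_ne_top {θ : ℂ → ℂ} (hθ : IsInner θ) {w : ℂ} (hw : w ∈ disc) :
    analyticOrderAt θ w ≠ ⊤ := by
  obtain ⟨z, hz, hne⟩ := hθ.exists_ne_zero
  refine (analyticOnNhd_disc hθ.holo).analyticOrderAt_ne_top_of_isPreconnected
    isPreconnected_disc hz hw ?_
  rw [((analyticOnNhd_disc hθ.holo) z hz).analyticOrderAt_eq_zero.2 hne]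
  exact ENat.zero_ne_top

/-- Every iterate maps the disc to itself and fixes `w`, so a Cauchy-type estimate bounds
`|φ'(w)|^n` uniformly in `n`. -/
lemma norm_deriv_le_one_of_fixedPoint {φ : ℂ → ℂ} (hφ : DifferentiableOn ℂ φ disc)
    (hmaps : MapsTo φ disc disc) {w : ℂ} (hw : w ∈ disc) (hfix : φ w = w) : ‖deriv φ w‖ ≤ 1 := by
  have hw1 : ‖w‖ < 1 := by simpa using hw
  have hsub : ball w (1 - ‖w‖) ⊆ disc := ball_subset_ball' (by simp)
  have hd : HasDerivAt φ (deriv φ w) w :=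
    (hφ.differentiableAt (isOpen_ball.mem_nhds hw)).hasDerivAt
  have hdiff : ∀ n : ℕ, DifferentiableOn ℂ φ^[n] disc := fun n ↦ by
    induction n with
    | zero => exact differentiableOn_id
    | succ n ih => exact ih.comp hφ hmaps
  have hbound : ∀ n : ℕ, ‖deriv φ w‖ ^ n ≤ 2 / (1 - ‖w‖) := fun n ↦ by
    rw [← norm_pow, ← (hd.iterate _ hfix n).deriv]
    refine norm_deriv_le_div_of_mapsTo_ball ((hdiff n).mono hsub) (fun z hz ↦ ?_) (by linarith)
    have hn : φ^[n] z ∈ disc := hmaps.iterate n (hsub hz)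
    rw [Function.iterate_fixed hfix, mem_closedBall, dist_eq_norm]
    have : ‖φ^[n] z‖ < 1 := by simpa using hn
    linarith [norm_sub_le (φ^[n] z) w]
  by_contra! h
  obtain ⟨n, hn⟩ := pow_unbounded_of_one_lt (2 / (1 - ‖w‖)) h
  exact (hbound n).not_gt hn

/-- The derivatives of `φ` and its inverse at `w` have product 1, and neither exceeds 1 in modulus.
-/
lemma IsDiscAutomorphism.norm_deriv_eq_one {φ : ℂ → ℂ} (hφ : IsDiscAutomorphism φ) {w : ℂ}
    (hw : w ∈ disc) (hfix : φ w = w) : ‖deriv φ w‖ = 1 := by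
  obtain ⟨hd, hmaps, ψ, hψd, hψmaps, hinv⟩ := hφ
  have hψfix : ψ w = w := by simpa [hfix] using hinv.1 hw
  have hnhds : disc ∈ 𝓝 w := isOpen_ball.mem_nhds hw
  have h1 : HasDerivAt φ (deriv φ w) w := (hd.differentiableAt hnhds).hasDerivAt
  have h2 : HasDerivAt ψ (deriv ψ w) (φ w) := by
    rw [hfix]; exact (hψd.differentiableAt hnhds).hasDerivAt
  have h3 : HasDerivAt id (deriv ψ w * deriv φ w) w :=
    (h2.comp w h1).congr_of_eventuallyEq
      (by filter_upwards [hnhds] with z hz using (hinv.1 hz).symm)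
  have h4 : ‖deriv ψ w‖ * ‖deriv φ w‖ = 1 := by
    rw [← norm_mul, h3.unique (hasDerivAt_id w), norm_one]
  have hle := norm_deriv_le_one_of_fixedPoint hd hmaps hw hfix
  have hψle := norm_deriv_le_one_of_fixedPoint hψd hψmaps hw hψfix
  nlinarith [norm_nonneg (deriv φ w)]

/-- Comparing leading coefficients in `θ ∘ φ = θ * g` at a fixed point of `φ`. -/
lemma eq_deriv_pow_of_comp_eq_mul {θ φ g : ℂ → ℂ} {w : ℂ} (hθ : AnalyticAt ℂ θ w)
    (htop : analyticOrderAt θ w ≠ ⊤) (hφ : DifferentiableAt ℂ φ w) (hfix : φ w = w)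
    (hg : ContinuousAt g w) (heq : ∀ᶠ z in 𝓝 w, θ (φ z) = θ z * g z) :
    g w = deriv φ w ^ analyticOrderNatAt θ w := by
  obtain ⟨h, hh, hh0, hfac⟩ := hθ.analyticOrderAt_ne_top.1 htop
  set n := analyticOrderNatAt θ w
  have hφt : Tendsto φ (𝓝 w) (𝓝 w) := by simpa [hfix] using hφ.continuousAt.tendsto
  have hslope : Tendsto (slope φ w) (𝓝[≠] w) (𝓝 (deriv φ w)) :=
    hasDerivAt_iff_tendsto_slope.1 hφ.hasDerivAt
  have h1 : Tendsto (fun z ↦ slope φ w z ^ n * h (φ z)) (𝓝[≠] w) (𝓝 (deriv φ w ^ n * h w)) :=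
    (hslope.pow n).mul ((hh.continuousAt.tendsto.comp hφt).mono_left nhdsWithin_le_nhds)
  have h2 : Tendsto (fun z ↦ g z * h z) (𝓝[≠] w) (𝓝 (g w * h w)) :=
    (hg.tendsto.mul hh.continuousAt.tendsto).mono_left nhdsWithin_le_nhds
  refine mul_right_cancel₀ hh0 (tendsto_nhds_unique (h2.congr' ?_) h1)
  filter_upwards [self_mem_nhdsWithin, nhdsWithin_le_nhds heq, nhdsWithin_le_nhds hfac,
    nhdsWithin_le_nhds (hφt.eventually hfac)] with z hz he hf hf'
  have hzw : z - w ≠ 0 := sub_ne_zero.2 hz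
  rw [hf, hf', smul_eq_mul, smul_eq_mul] at he
  rw [slope_def_field, hfix, div_pow, div_mul_eq_mul_div, he]
  field_simp

/-! ### The two implications. -/

lemma quotientIsConst_of_isInvariant {θ φ : ℂ → ℂ} (hθ : IsInner θ) (hφ : IsDiscAutomorphism φ)
    (hinv : IsInvariantUnderComp φ (beurlingSubspace θ)) {w : ℂ} (hw : w ∈ disc)
    (hfix : φ w = w) : QuotientIsConst θ φ (deriv φ w ^ analyticOrderNatAt θ w) := by
  obtain ⟨g, hg, heq⟩ := hinv (show θ ∈ beurlingSubspace θ from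
    ⟨_, one_mem_hardySpace, fun z _ ↦ (mul_one _).symm⟩)
  have hnhds : disc ∈ 𝓝 w := isOpen_ball.mem_nhds hw
  have hg1 : ∀ z ∈ disc, ‖g z‖ ≤ 1 := fun z hz ↦ hθ.norm_le_one_of_mul hg
    (fun ζ hζ ↦ heq ζ hζ ▸ hθ.norm_le_one _ (hφ.2.1 hζ)) hz
  have hgw : g w = deriv φ w ^ analyticOrderNatAt θ w :=
    eq_deriv_pow_of_comp_eq_mul (analyticOnNhd_disc hθ.holo w hw) (hθ.analyticOrderAt_ne_top hw)
      (hφ.1.differentiableAt hnhds) hfix (hg.1.continuousOn.continuousAt hnhds)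
      (by filter_upwards [hnhds] with z hz using heq z hz)
  have hnorm : ‖g w‖ = 1 := by rw [hgw, norm_pow, hφ.norm_deriv_eq_one hw hfix, one_pow]
  have hconst : EqOn g (Function.const ℂ (g w)) disc :=
    Complex.eqOn_of_isPreconnected_of_isMaxOn_norm isPreconnected_disc isOpen_ball hg.1 hw
      fun z hz ↦ by simpa [hnorm] using hg1 z hz
  intro z hz hne
  have h := heq z hz
  simp only [compositionOp, Function.comp_apply] at h
  rw [h, mul_div_cancel_left₀ _ hne, hconst hz, Function.const_apply, hgw]

/-- The identity theorem carries the relation across the zeros of `θ`, where the quotient says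
nothing. -/
lemma QuotientIsConst.comp_eq {θ φ : ℂ → ℂ} (hθ : IsInner θ) (hφ : IsDiscAutomorphism φ) {c : ℂ}
    (hc : QuotientIsConst θ φ c) : EqOn (θ ∘ φ) (fun z ↦ c * θ z) disc := by
  obtain ⟨z, hz, hne⟩ := hθ.exists_ne_zero
  have hnhds : disc ∈ 𝓝 z := isOpen_ball.mem_nhds hz
  refine (analyticOnNhd_disc (hθ.holo.comp hφ.1 hφ.2.1)).eqOn_of_preconnected_of_eventuallyEq
    (analyticOnNhd_disc (hθ.holo.const_mul c)) isPreconnected_disc hz ?_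
  filter_upwards [hnhds, (hθ.holo.continuousOn.continuousAt hnhds).eventually_ne hne] with x hx hx0
  exact (div_eq_iff hx0).1 (hc x hx hx0)

lemma isInvariant_of_quotientIsConst {θ φ : ℂ → ℂ} (hθ : IsInner θ) (hφ : IsDiscAutomorphism φ)
    {c : ℂ} (hc : QuotientIsConst θ φ c) :
    IsInvariantUnderComp φ (beurlingSubspace θ) := by
  rintro f ⟨g, hg, hf⟩
  obtain ⟨M, -, hM⟩ := exists_circleAverage_le (comp_mem_hardySpace hφ.1 hφ.2.1 hg)
  refine ⟨fun z ↦ c * g (φ z), mem_hardySpace_of_circleAverage_le (M := ‖c‖ ^ 2 * M)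
    ((hg.1.comp hφ.1 hφ.2.1).const_mul c) fun r h0 h1 ↦ ?_, fun z hz ↦ ?_⟩
  · simp only [norm_mul, mul_pow, ← smul_eq_mul (‖c‖ ^ 2)]
    rw [circleAverage_fun_smul]
    exact mul_le_mul_of_nonneg_left (hM r h0 h1) (by positivity)
  · have h := hc.comp_eq hθ hφ hz
    simp only [Function.comp_apply] at h
    simp only [compositionOp, Function.comp_apply]
    rw [hf _ (hφ.2.1 hz), h]
    ring

end HardyDisc

theorem theorem3p3 (θ φ : ℂ → ℂ) (hθ : HardyDisc.IsInner θ)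
    (hφ : HardyDisc.IsEllipticAutomorphism φ) :
    (HardyDisc.IsInvariantUnderComp φ (HardyDisc.beurlingSubspace θ) ↔
      ∃ c : ℂ, ‖c‖ = 1 ∧ HardyDisc.QuotientIsConst θ φ c) ∧
    (HardyDisc.IsInvariantUnderComp φ (HardyDisc.beurlingSubspace θ) →
      ∀ w ∈ HardyDisc.disc, φ w = w →
        (θ w = 0 →
          HardyDisc.QuotientIsConst θ φ (deriv φ w ^ analyticOrderNatAt θ w)) ∧
        (θ w ≠ 0 → HardyDisc.QuotientIsConst θ φ 1)) := by
  obtain ⟨haut, w, ⟨hw, hfix⟩, -⟩ := hφ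
  refine ⟨⟨fun hinv ↦ ⟨_, ?_, HardyDisc.quotientIsConst_of_isInvariant hθ haut hinv hw hfix⟩,
    fun ⟨c, _, hc⟩ ↦ HardyDisc.isInvariant_of_quotientIsConst hθ haut hc⟩,
    fun hinv v hv hvfix ↦ ?_⟩
  · rw [norm_pow, haut.norm_deriv_eq_one hw hfix, one_pow]
  · have h := HardyDisc.quotientIsConst_of_isInvariant hθ haut hinv hv hvfix
    refine ⟨fun _ ↦ h, fun hne ↦ ?_⟩
    have h0 : analyticOrderNatAt θ v = 0 := by
      rw [analyticOrderNatAt,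
        (HardyDisc.analyticOnNhd_disc hθ.holo v hv).analyticOrderAt_eq_zero.2 hne, ENat.toNat_zero]
    simpa [h0] using h
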